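/- Let $p,n,q,m,s,l$ be positive integers with $$p\ge q\ge s\ge 2,\quad 1\le n\le p,\quad 1\le m\le q,\quad 1\le l\le s,\quad p+1\le s+q,$$ $$n+m\ne q+1,\qquad n+l\ne p+1,$$ such that moreover: if $m>q+s-p$ then $n+m\neq 2q+1$ and $n+m\ne 2q-p+1$; if $l<p-s$ and $l\le p-q$ then $n+l\ne p-s+1$; if $m\le q+s-p$ then $m+l\ne s+1$. (Then $(p,n,q,m,s,l)$ is called a *3-butterfly*.) Put $t=p+q-s$, $v=q+s-p$, $w=p+s-q$, and consider labels $a_i$ $(i\in\mathbb Z/2p)$, $b_j$ $(j\in\mathbb Z/2q)$, $c_h$ $(h\in\mathbb Z/2s)$. *Canonical diagram.* Draw three disjoint segments, the bridges $a,b,c$, divided into $p$, $q$, $s$ parts. Bridge $a$ runs from the point $a_0$ to the point $a_p$; at its $i$-th division point, $0<i<p$, an underpassing strand crosses below it and joins the points $a_i$ and $a_{2p-i}$ on the two sides of the bridge. The bridges $b$ (from $b_0$ to $b_q$) and $c$ (from $c_0$ to $c_s$) are treated in the same way. Outside the bridges, join the labelled points by the pairwise disjoint arcs $a_{n-j}b_{m+j-1}$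 $(1\le j\le t)$, $b_{m-j}c_{l+j-1}$ $(1\le j\le v)$, $c_{l-j}a_{n+j-1}$ $(1\le j\le w)$. This is a link diagram; $L$ denotes the link it represents. The symbol $(p/n,q/m,s/l)$ is called a *Schubert form* if the 3-butterfly is reduced, i.e. if the diagram has no trivial component, meaning a component that runs along none of the three bridges. *Permutations.* On the set of all labels let $\gamma(a_i)=a_{2p-i}$, $\gamma(b_j)=b_{2q-j}$, $\gamma(c_h)=c_{2s-h}$, and let $\phi$ be the involution with $$a_{n-i}\leftrightarrow b_{m+i-1}\ (1\le i\le t),\qquad a_{n+j}\leftrightarrow c_{l-j-1}\ (0\le j\le w-1),\qquad b_{m-h}\leftrightarrow c_{l+h-1}\ (1\le h\le v).$$ Let $\mu=\phi\gamma$ (first $\gamma$, then $\phi$), and let $\mathcal O_\mu(x)$ be the orbit of $x$ under $\mu$. **Theorem (Classification).** Let $(p/n,q/m,s/l)$ be a Schubert form. Then: 1. $L$ is a knot (has exactly one component) if and only if $a_p\notin\mathcal O_\mu(a_0)$, $b_q\notin\mathcal O_\mu(b_0)$ and $c_s\notin\mathcal O_\mu(c_0)$. 2. $L$ is a two-component link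 if and only if exactly one of the conditions $a_p\in\mathcal O_\mu(a_0)$, $b_q\in\mathcal O_\mu(b_0)$, $c_s\in\mathcal O_\mu(c_0)$ holds. 3. $L$ is a three-component link if and only if $a_p\in\mathcal O_\mu(a_0)$, $b_q\in\mathcal O_\mu(b_0)$ and $c_s\in\mathcal O_\mu(c_0)$. -/

import Mathlib

/-- A 3-butterfly `(p, n, q, m, s, l)`.  Truncated subtraction is avoided by moving terms to the
other side: `m > q + s - p` reads `q + s < m + p`, `n + m ≠ 2q - p + 1` reads
`n + m + p ≠ 2q + 1`, and so on.  In `n_add_l_ne'` the hypothesis is `l < p - s` together with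
`l ≤ p - q`, so that the condition is the weaker one of the two variants with only one of these
inequalities. -/
structure ThreeButterfly where
  p : ℕ
  n : ℕ
  q : ℕ
  m : ℕ
  s : ℕ
  l : ℕ
  q_le_p : q ≤ p
  s_le_q : s ≤ q
  two_le_s : 2 ≤ s
  one_le_n : 1 ≤ n
  n_le_p : n ≤ p
  one_le_m : 1 ≤ m
  m_le_q : m ≤ q
  one_le_l : 1 ≤ l
  l_le_s : l ≤ s
  p_lt : p + 1 ≤ s + q
  n_add_m_ne : n + m ≠ q + 1
  n_add_l_ne : n + l ≠ p + 1
  n_add_m_ne' : q + s < m + p → n + m ≠ 2 * q + 1 ∧ n + m + p ≠ 2 * q + 1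
  n_add_l_ne' : l + s < p → l + q ≤ p → n + l + s ≠ p + 1
  m_add_l_ne : m + p ≤ q + s → m + l ≠ s + 1

/-- The names of the three bridges (and of the butterflies around them). -/
inductive Letter
  | a
  | b
  | c

namespace ThreeButterfly

variable (B : ThreeButterfly)

/-- The number of segments into which each bridge is divided: `p`, `q`, `s`. -/
def size : Letter → ℕ
  | .a => B.p
  | .b => B.q
  | .c => B.s

/-- The number `t = p + q - s` of arcs between the bridges `a` and `b`. -/
def t : ℕ := B.p + B.q - B.s

/-- The number `v = q + s - p` of arcs between the bridges `b` and `c`. -/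
def v : ℕ := B.q + B.s - B.p

/-- The number `w = p + s - q` of arcs between the bridges `c` and `a`. -/
def w : ℕ := B.p + B.s - B.q

/-- The set `A ∪ B ∪ C` of labels `a_i` (`i ∈ ℤ/2p`), `b_j` (`j ∈ ℤ/2q`), `c_h` (`h ∈ ℤ/2s`). -/
abbrev Vertex : Type := Σ k : Letter, ZMod (2 * B.size k)

/-- The label `a_i`. -/
abbrev a (i : ZMod (2 * B.p)) : B.Vertex := ⟨.a, i⟩

/-- The label `b_j`. -/
abbrev b (j : ZMod (2 * B.q)) : B.Vertex := ⟨.b, j⟩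

/-- The label `c_h`. -/
abbrev c (h : ZMod (2 * B.s)) : B.Vertex := ⟨.c, h⟩

/-! ### The canonical link diagram -/

/-- Marked points on the link drawn by the canonical diagram: the labelled points, and for each
bridge `k` its `size k + 1` division points, numbered from `0` to `size k`.  The division points
`0 < i < size k` are the crossings on the bridge `k`, where the bridge is the overpass. -/
abbrev Site : Type := B.Vertex ⊕ (Σ k : Letter, Fin (B.size k + 1))

/-- A labelled point as a point of the link. -/
abbrev label (x : B.Vertex) : B.Site := Sum.inl x

/-- The `i`-th division point of the bridge `k` as a point of the link (on the overpass). -/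
abbrev onBridge (k : Letter) (i : Fin (B.size k + 1)) : B.Site := Sum.inr ⟨k, i⟩

/-- The elementary pieces of the canonical diagram, as strands of the link.  At the crossing
in the `i`-th division point of the bridge `k` (`0 < i < size k`) the bridge runs above the
strand that joins the left point with label `i` to the right point with label
`2 * size k - i = -i`; the two strands do not meet in the link. -/
inductive Strand : B.Site → B.Site → Prop
  /-- a segment of a bridge, between consecutive division points -/
  | bridge (k : Letter) (i : Fin (B.size k)) :
      Strand (B.onBridge k i.castSucc) (B.onBridge k i.succ)
  /-- the bridge begins in the point with label `0` -/
  | bridgeStart (k : Letter) : Strand (B.label ⟨k, 0⟩) (B.onBridge k 0)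
  /-- the bridge ends in the point with label `size k` -/
  | bridgeEnd (k : Letter) :
      Strand (B.label ⟨k, (B.size k : ZMod (2 * B.size k))⟩) (B.onBridge k (Fin.last (B.size k)))
  /-- the underpass in the `i`-th crossing of a bridge -/
  | under (k : Letter) (i : ℕ) (h0 : 0 < i) (h1 : i < B.size k) :
      Strand (B.label ⟨k, (i : ZMod (2 * B.size k))⟩)
        (B.label ⟨k, ((2 * B.size k - i : ℕ) : ZMod (2 * B.size k))⟩)
  /-- the arcs `a_{n-j} b_{m+j-1}` -/
  | arcAB (j : ℕ) (h0 : 1 ≤ j) (h1 : j ≤ B.t) :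
      Strand (B.label (B.a (B.n - j))) (B.label (B.b (B.m + j - 1)))
  /-- the arcs `b_{m-j} c_{l+j-1}` -/
  | arcBC (j : ℕ) (h0 : 1 ≤ j) (h1 : j ≤ B.v) :
      Strand (B.label (B.b (B.m - j))) (B.label (B.c (B.l + j - 1)))
  /-- the arcs `c_{l-j} a_{n+j-1}` -/
  | arcCA (j : ℕ) (h0 : 1 ≤ j) (h1 : j ≤ B.w) :
      Strand (B.label (B.c (B.l - j))) (B.label (B.a (B.n + j - 1)))

/-- The link drawn by the canonical diagram, as a graph: a disjoint union of closed curves, each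
subdivided by its marked points. -/
def link : SimpleGraph B.Site := SimpleGraph.fromRel B.Strand

/-- The number of components of the link. -/
noncomputable def numComponents : ℕ := Nat.card B.link.ConnectedComponent

/-- `(p/n, q/m, s/l)` is a Schubert form: the butterfly is reduced, i.e. no component of its diagram is a trivial component, that is, a closed
curve which runs along no bridge (and so lies below the rest of the diagram). -/
def IsSchubertForm : Prop :=
  ∀ K : B.link.ConnectedComponent, ∃ k i, B.link.connectedComponentMk (B.onBridge k i) = K

/-! ### The permutations `γ`, `φ` and `μ` -/

/-- The reflection `γ` along the bridges: `a_i ↦ a_{2p-i}`, `b_j ↦ b_{2q-j}`, `c_h ↦ c_{2s-h}`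
(the subscripts are residues, so that `2p - i = -i`). -/
def gamma : Equiv.Perm B.Vertex where
  toFun x := ⟨x.1, -x.2⟩
  invFun x := ⟨x.1, -x.2⟩
  left_inv x := by simp
  right_inv x := by simp

/-- The values `φ(a_x)`. -/
def phiA (x : ZMod (2 * B.p)) : B.Vertex :=
  if (x - B.n).val < B.w then B.c (B.l - (x - B.n).val - 1)
  else B.b (B.m + (2 * B.p - (x - B.n).val : ℕ) - 1)

/-- The values `φ(b_x)`. -/
def phiB (x : ZMod (2 * B.q)) : B.Vertex :=
  if (x - B.m).val < B.t then B.a (B.n - (x - B.m).val - 1)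
  else B.c (B.l + (2 * B.q - (x - B.m).val : ℕ) - 1)

/-- The values `φ(c_x)`. -/
def phiC (x : ZMod (2 * B.s)) : B.Vertex :=
  if (x - B.l).val < B.v then B.b (B.m - (x - B.l).val - 1)
  else B.a (B.n + (2 * B.s - (x - B.l).val : ℕ) - 1)

/-- The function underlying `φ`; the facts `phi_a_sub`, `phi_a_add` and `phi_b_sub` below are the
rules that define it. -/
def phiFun : B.Vertex → B.Vertex
  | ⟨.a, x⟩ => B.phiA x
  | ⟨.b, x⟩ => B.phiB x
  | ⟨.c, x⟩ => B.phiC x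

theorem val_neg_natCast {N i : ℕ} (h0 : 1 ≤ i) (h1 : i ≤ N) :
    ((-(i : ZMod N)).val) = N - i := by
  have h : (-(i : ZMod N)) = ((N - i : ℕ) : ZMod N) := by
    rw [Nat.cast_sub h1, ZMod.natCast_self, zero_sub]
  rw [h, ZMod.val_cast_of_lt (by omega)]

/-- Every residue mod `N` is `y + j` with `0 ≤ j < k` or `y - i` with `1 ≤ i ≤ N - k`. -/
theorem residue_cases {N : ℕ} (hN : 0 < N) (k : ℕ) (x y : ZMod N) :
    (∃ j : ℕ, j < k ∧ j < N ∧ x = y + j) ∨ (∃ i : ℕ, 1 ≤ i ∧ i + k ≤ N ∧ x = y - i) := by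
  have : NeZero N := ⟨hN.ne'⟩
  have hv : (x - y).val < N := ZMod.val_lt _
  have hx : x = y + ((x - y).val : ZMod N) := by
    rw [ZMod.natCast_zmod_val]; ring
  by_cases h : (x - y).val < k
  · exact Or.inl ⟨_, h, hv, hx⟩
  · refine Or.inr ⟨N - (x - y).val, by omega, by omega, ?_⟩
    rw [Nat.cast_sub hv.le, ZMod.natCast_self]
    nth_rewrite 1 [hx]
    ring

theorem phiFun_a_sub (i : ℕ) (h0 : 1 ≤ i) (h1 : i ≤ B.t) :
    B.phiFun (B.a (B.n - i)) = B.b (B.m + i - 1) := by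
  have := B.q_le_p; have := B.s_le_q; have := B.p_lt
  unfold t at h1
  have hv : ((B.n : ZMod (2 * B.p)) - i - B.n).val = 2 * B.p - i := by
    rw [show (B.n : ZMod (2 * B.p)) - i - B.n = -(i : ZMod (2 * B.p)) by ring]
    exact val_neg_natCast h0 (by omega)
  show B.phiA _ = _
  unfold phiA
  rw [hv, if_neg (by unfold w; omega), show 2 * B.p - (2 * B.p - i) = i by omega]

theorem phiFun_a_add (j : ℕ) (h : j < B.w) :
    B.phiFun (B.a (B.n + j)) = B.c (B.l - j - 1) := by
  have := B.q_le_p; have := B.s_le_q; have := B.p_lt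
  have hv : ((B.n : ZMod (2 * B.p)) + j - B.n).val = j := by
    rw [add_sub_cancel_left]
    exact ZMod.val_cast_of_lt (by unfold w at h; omega)
  show B.phiA _ = _
  unfold phiA
  rw [hv, if_pos h]

theorem phiFun_b_sub (h : ℕ) (h0 : 1 ≤ h) (h1 : h ≤ B.v) :
    B.phiFun (B.b (B.m - h)) = B.c (B.l + h - 1) := by
  have := B.q_le_p; have := B.s_le_q; have := B.p_lt
  unfold v at h1
  have hv : ((B.m : ZMod (2 * B.q)) - h - B.m).val = 2 * B.q - h := by
    rw [show (B.m : ZMod (2 * B.q)) - h - B.m = -(h : ZMod (2 * B.q)) by ring]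
    exact val_neg_natCast h0 (by omega)
  show B.phiB _ = _
  unfold phiB
  rw [hv, if_neg (by unfold t; omega), show 2 * B.q - (2 * B.q - h) = h by omega]

theorem phiFun_b_add (j : ℕ) (h : j < B.t) :
    B.phiFun (B.b (B.m + j)) = B.a (B.n - j - 1) := by
  have := B.q_le_p; have := B.s_le_q; have := B.p_lt
  have hv : ((B.m : ZMod (2 * B.q)) + j - B.m).val = j := by
    rw [add_sub_cancel_left]
    exact ZMod.val_cast_of_lt (by unfold t at h; omega)
  show B.phiB _ = _
  unfold phiB
  rw [hv, if_pos h]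

theorem phiFun_c_sub (i : ℕ) (h0 : 1 ≤ i) (h1 : i ≤ B.w) :
    B.phiFun (B.c (B.l - i)) = B.a (B.n + i - 1) := by
  have := B.q_le_p; have := B.s_le_q; have := B.p_lt
  unfold w at h1
  have hv : ((B.l : ZMod (2 * B.s)) - i - B.l).val = 2 * B.s - i := by
    rw [show (B.l : ZMod (2 * B.s)) - i - B.l = -(i : ZMod (2 * B.s)) by ring]
    exact val_neg_natCast h0 (by omega)
  show B.phiC _ = _
  unfold phiC
  rw [hv, if_neg (by unfold v; omega), show 2 * B.s - (2 * B.s - i) = i by omega]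

theorem phiFun_c_add (j : ℕ) (h : j < B.v) :
    B.phiFun (B.c (B.l + j)) = B.b (B.m - j - 1) := by
  have := B.q_le_p; have := B.s_le_q; have := B.p_lt
  have hv : ((B.l : ZMod (2 * B.s)) + j - B.l).val = j := by
    rw [add_sub_cancel_left]
    exact ZMod.val_cast_of_lt (by unfold v at h; omega)
  show B.phiC _ = _
  unfold phiC
  rw [hv, if_pos h]

theorem phiFun_involutive : Function.Involutive B.phiFun := by
  have h1 := B.q_le_p
  have h2 := B.s_le_q
  have h3 := B.p_lt
  have h4 := B.two_le_s
  rintro ⟨k, x⟩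
  cases k with
  | a =>
    change ZMod (2 * B.p) at x
    rcases residue_cases (by omega) B.w x B.n with ⟨j, hj, -, rfl⟩ | ⟨i, hi, hi', rfl⟩
    · rw [B.phiFun_a_add j hj]
      have := B.phiFun_c_sub (j + 1) (by omega) (by omega)
      push_cast at this
      rw [← sub_sub, ← add_assoc, add_sub_cancel_right] at this
      exact this
    · have hi'' : i ≤ B.t := by unfold w at hi'; unfold t; omega
      rw [B.phiFun_a_sub i hi hi'']
      obtain ⟨j, rfl⟩ : ∃ j, i = j + 1 := ⟨i - 1, by omega⟩
      have := B.phiFun_b_add j (by omega)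
      push_cast
      rw [← sub_sub, ← add_assoc, add_sub_cancel_right]
      exact this
  | b =>
    change ZMod (2 * B.q) at x
    rcases residue_cases (by omega) B.t x B.m with ⟨j, hj, -, rfl⟩ | ⟨i, hi, hi', rfl⟩
    · rw [B.phiFun_b_add j hj]
      have := B.phiFun_a_sub (j + 1) (by omega) (by omega)
      push_cast at this
      rw [← sub_sub, ← add_assoc, add_sub_cancel_right] at this
      exact this
    · have hi'' : i ≤ B.v := by unfold t at hi'; unfold v; omega
      rw [B.phiFun_b_sub i hi hi'']
      obtain ⟨j, rfl⟩ : ∃ j, i = j + 1 := ⟨i - 1, by omega⟩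
      have := B.phiFun_c_add j (by omega)
      push_cast
      rw [← sub_sub, ← add_assoc, add_sub_cancel_right]
      exact this
  | c =>
    change ZMod (2 * B.s) at x
    rcases residue_cases (by omega) B.v x B.l with ⟨j, hj, -, rfl⟩ | ⟨i, hi, hi', rfl⟩
    · rw [B.phiFun_c_add j hj]
      have := B.phiFun_b_sub (j + 1) (by omega) (by omega)
      push_cast at this
      rw [← sub_sub, ← add_assoc, add_sub_cancel_right] at this
      exact this
    · have hi'' : i ≤ B.w := by unfold v at hi'; unfold w; omega
      rw [B.phiFun_c_sub i hi hi'']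
      obtain ⟨j, rfl⟩ : ∃ j, i = j + 1 := ⟨i - 1, by omega⟩
      have := B.phiFun_a_add j (by omega)
      push_cast
      rw [← sub_sub, ← add_assoc, add_sub_cancel_right]
      exact this

/-- The permutation `φ`, of order two. -/
def phi : Equiv.Perm B.Vertex := B.phiFun_involutive.toPerm

/-- `a_{n-i} ↔ b_{m+i-1}` for `1 ≤ i ≤ t`. -/
theorem phi_a_sub (i : ℕ) (h0 : 1 ≤ i) (h1 : i ≤ B.t) :
    B.phi (B.a (B.n - i)) = B.b (B.m + i - 1) ∧ B.phi (B.b (B.m + i - 1)) = B.a (B.n - i) := by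
  have h := B.phiFun_a_sub i h0 h1
  exact ⟨h, by rw [← h]; exact B.phiFun_involutive _⟩

/-- `a_{n+j} ↔ c_{l-j-1}` for `0 ≤ j ≤ w - 1`. -/
theorem phi_a_add (j : ℕ) (h : j < B.w) :
    B.phi (B.a (B.n + j)) = B.c (B.l - j - 1) ∧ B.phi (B.c (B.l - j - 1)) = B.a (B.n + j) := by
  have h := B.phiFun_a_add j h
  exact ⟨h, by rw [← h]; exact B.phiFun_involutive _⟩

/-- `b_{m-h} ↔ c_{l+h-1}` for `1 ≤ h ≤ v`. -/
theorem phi_b_sub (h : ℕ) (h0 : 1 ≤ h) (h1 : h ≤ B.v) :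
    B.phi (B.b (B.m - h)) = B.c (B.l + h - 1) ∧ B.phi (B.c (B.l + h - 1)) = B.b (B.m - h) := by
  have h' := B.phiFun_b_sub h h0 h1
  exact ⟨h', by rw [← h']; exact B.phiFun_involutive _⟩

/-- The permutation `μ = φγ`, which applies `γ` first. -/
def mu : Equiv.Perm B.Vertex := B.phi * B.gamma

/-- The orbit of `x` under `μ`. -/
def orbitMu (x : B.Vertex) : Set B.Vertex := MulAction.orbit (Subgroup.zpowers B.mu) x

end ThreeButterfly

/-! The involutions `γ` and `φ` follow the strands below the bridges: `γ` passes under a bridge and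
`φ` runs along an arc.  The fixed points of `γ` are the ends of the bridges, and `φ` has none, so in
the dihedral orbit of the end `k_0` there is exactly one further end of a bridge: the place where
the link, having left the bridge `k` at `k_0`, next comes up to a bridge.  Hence the bridge `k` is
the only bridge on its component precisely when this place is its own other end.  On a Schubert form
every component runs along a bridge, so the components are the classes of a partition of the three
bridges, and a partition of a three-element set into 1, 2 or 3 classes has 0, 1 or 3 singletons. -/

section DihedralOrbits

variable {X : Type*} {f g m : Equiv.Perm X} {x y : X}

theorem mem_orbit_zpowers_iff_exists_zpow_apply_eq :
    y ∈ MulAction.orbit (Subgroup.zpowers m) x ↔ ∃ i : ℤ, (m ^ i) x = y := by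
  simp only [MulAction.mem_orbit_iff, Subgroup.exists_zpowers, Subgroup.smul_def,
    Equiv.Perm.smul_def]

theorem zpow_apply_eq_self_iff_minimalPeriod_dvd {i : ℤ} :
    (m ^ i) x = x ↔ (Function.minimalPeriod m x : ℤ) ∣ i :=
  MulAction.zpow_smul_eq_iff_minimalPeriod_dvd (a := m) (b := x)

theorem zpow_apply_eq_zpow_apply_iff_minimalPeriod_dvd {i j : ℤ} :
    (m ^ i) x = (m ^ j) x ↔ (Function.minimalPeriod m x : ℤ) ∣ i - j := by
  rw [← zpow_apply_eq_self_iff_minimalPeriod_dvd, sub_eq_neg_add, zpow_add, Equiv.Perm.mul_apply,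
    zpow_neg, Equiv.Perm.inv_eq_iff_eq]

theorem apply_mul_zpow_apply_of_involutive (hf : Function.Involutive f)
    (hg : Function.Involutive g) (hx : g x = x) (i : ℤ) :
    g (((f * g) ^ i) x) = ((f * g) ^ (-i)) x := by
  have hinv : g * (f * g) = (f * g)⁻¹ * g := by
    have hf_inv : f⁻¹ = f := inv_eq_of_mul_eq_one_left (Equiv.ext hf)
    have hg_inv : g⁻¹ = g := inv_eq_of_mul_eq_one_left (Equiv.ext hg)
    rw [mul_inv_rev, hf_inv, hg_inv, mul_assoc]
  have hconj : g * (f * g) ^ i = ((f * g)⁻¹) ^ i * g :=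
    SemiconjBy.zpow_right (show SemiconjBy g (f * g) (f * g)⁻¹ from hinv) i
  rw [← Equiv.Perm.mul_apply, hconj, Equiv.Perm.mul_apply, hx, inv_zpow, zpow_neg]

theorem right_apply_mem_orbit_zpowers_mul (hf : Function.Involutive f)
    (hg : Function.Involutive g) (hx : g x = x)
    (hy : y ∈ MulAction.orbit (Subgroup.zpowers (f * g)) x) :
    g y ∈ MulAction.orbit (Subgroup.zpowers (f * g)) x := by
  obtain ⟨i, rfl⟩ := mem_orbit_zpowers_iff_exists_zpow_apply_eq.1 hy
  exact mem_orbit_zpowers_iff_exists_zpow_apply_eq.2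
    ⟨-i, (apply_mul_zpow_apply_of_involutive hf hg hx i).symm⟩

theorem left_apply_mem_orbit_zpowers_mul (hf : Function.Involutive f)
    (hg : Function.Involutive g) (hx : g x = x)
    (hy : y ∈ MulAction.orbit (Subgroup.zpowers (f * g)) x) :
    f y ∈ MulAction.orbit (Subgroup.zpowers (f * g)) x := by
  obtain ⟨i, hi⟩ := mem_orbit_zpowers_iff_exists_zpow_apply_eq.1
    (right_apply_mem_orbit_zpowers_mul hf hg hx hy)
  refine mem_orbit_zpowers_iff_exists_zpow_apply_eq.2 ⟨1 + i, ?_⟩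
  rw [zpow_add, zpow_one, Equiv.Perm.mul_apply, hi, Equiv.Perm.mul_apply, hg]

theorem apply_mul_zpow_apply_eq_self_iff (hf : Function.Involutive f)
    (hg : Function.Involutive g) (hx : g x = x) {i : ℤ} :
    g (((f * g) ^ i) x) = ((f * g) ^ i) x ↔
      (Function.minimalPeriod (f * g) x : ℤ) ∣ 2 * i := by
  rw [apply_mul_zpow_apply_of_involutive hf hg hx,
    zpow_apply_eq_zpow_apply_iff_minimalPeriod_dvd, ← dvd_neg, neg_sub, sub_neg_eq_add, two_mul]

theorem even_minimalPeriod_mul_of_involutive (hf : Function.Involutive f)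
    (hf_ne : ∀ y, f y ≠ y) (hg : Function.Involutive g) (hx : g x = x) :
    Even (Function.minimalPeriod (f * g) x) := by
  by_contra hodd
  obtain ⟨r, hr⟩ := Nat.not_even_iff_odd.1 hodd
  -- Reflecting an odd cycle about `x` leaves two neighbouring points opposite to `x`, which `f`
  -- would have to identify.
  have hfixed : f (((f * g) ^ (-r : ℤ)) x) = ((f * g) ^ (-r : ℤ)) x :=
    calc f (((f * g) ^ (-r : ℤ)) x)
        = f (g (((f * g) ^ (r : ℤ)) x)) := by
          rw [apply_mul_zpow_apply_of_involutive hf hg hx]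
      _ = ((f * g) ^ (1 + r : ℤ)) x := by rw [zpow_add, zpow_one]; rfl
      _ = ((f * g) ^ (-r : ℤ)) x :=
          zpow_apply_eq_zpow_apply_iff_minimalPeriod_dvd.2 ⟨1, by rw [hr]; push_cast; ring⟩
  exact hf_ne _ hfixed

theorem exists_fixedPoints_inter_orbit_zpowers_mul_eq_pair (hf : Function.Involutive f)
    (hf_ne : ∀ y, f y ≠ y) (hg : Function.Involutive g) (hx : g x = x)
    (hper : x ∈ Function.periodicPts (f * g)) :
    ∃ y ≠ x, Function.fixedPoints g ∩ MulAction.orbit (Subgroup.zpowers (f * g)) x = {x, y} := by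
  obtain ⟨r, hr⟩ := even_minimalPeriod_mul_of_involutive hf hf_ne hg hx
  have hr_pos : 0 < r := by
    have := Function.minimalPeriod_pos_of_mem_periodicPts hper
    omega
  have hfixed : ∀ {i : ℤ}, g (((f * g) ^ i) x) = ((f * g) ^ i) x ↔ (r : ℤ) ∣ i := by
    intro i
    rw [apply_mul_zpow_apply_eq_self_iff hf hg hx, hr, ← two_mul, Nat.cast_mul, Nat.cast_two]
    exact mul_dvd_mul_iff_left two_ne_zero
  refine ⟨((f * g) ^ (r : ℤ)) x, fun h => ?_, Set.Subset.antisymm ?_ ?_⟩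
  · rw [zpow_apply_eq_self_iff_minimalPeriod_dvd, hr, Int.natCast_dvd_natCast] at h
    have := Nat.le_of_dvd hr_pos h
    omega
  · rintro z ⟨hz, hzmem⟩
    obtain ⟨i, rfl⟩ := mem_orbit_zpowers_iff_exists_zpow_apply_eq.1 hzmem
    obtain ⟨c, rfl⟩ := hfixed.1 hz
    rcases Int.even_or_odd' c with ⟨d, rfl | rfl⟩
    · left
      exact zpow_apply_eq_self_iff_minimalPeriod_dvd.2 ⟨d, by rw [hr]; push_cast; ring⟩
    · right
      exact zpow_apply_eq_zpow_apply_iff_minimalPeriod_dvd.2 ⟨d, by rw [hr]; push_cast; ring⟩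
  · rintro z (rfl | rfl)
    · exact ⟨hx, MulAction.mem_orbit_self _⟩
    · exact ⟨hfixed.2 dvd_rfl, mem_orbit_zpowers_iff_exists_zpow_apply_eq.2 ⟨r, rfl⟩⟩

end DihedralOrbits

section ReachabilityFromRel

variable {V : Type*} {r : V → V → Prop} {x y : V}

theorem reachable_fromRel_of_rel (h : r x y) : (SimpleGraph.fromRel r).Reachable x y := by
  by_cases hxy : x = y
  · rw [hxy]
  · exact SimpleGraph.Adj.reachable ((SimpleGraph.fromRel_adj r x y).2 ⟨hxy, Or.inl h⟩)

theorem mem_iff_mem_of_reachable_fromRel {S : Set V} (hS : ∀ u v, r u v → (u ∈ S ↔ v ∈ S))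
    (h : (SimpleGraph.fromRel r).Reachable x y) : x ∈ S ↔ y ∈ S := by
  obtain ⟨walk⟩ := h
  induction walk with
  | nil => rfl
  | cons hadj _ ih =>
    rcases ((SimpleGraph.fromRel_adj r _ _).1 hadj).2 with huv | hvu
    · exact (hS _ _ huv).trans ih
    · exact (hS _ _ hvu).symm.trans ih

end ReachabilityFromRel

namespace Letter

instance : Finite Letter :=
  Set.finite_univ_iff.1 ((Set.toFinite {a, b, c}).subset fun k _ => by cases k <;> simp)

variable {P : Letter → Prop}

theorem forall_iff : (∀ k, P k) ↔ P a ∧ P b ∧ P c :=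
  ⟨fun h => ⟨h a, h b, h c⟩, fun ⟨ha, hb, hc⟩ k => by cases k <;> assumption⟩

theorem exists_iff : (∃ k, P k) ↔ P a ∨ P b ∨ P c := by
  simpa only [not_forall, not_not, not_and_or] using not_congr (forall_iff (P := fun k => ¬ P k))

theorem existsUnique_iff :
    (∃! k, P k) ↔ (P a ∧ ¬ P b ∧ ¬ P c) ∨ (¬ P a ∧ P b ∧ ¬ P c) ∨ (¬ P a ∧ ¬ P b ∧ P c) := by
  simp only [ExistsUnique, exists_iff, forall_iff, reduceCtorEq, imp_false, implies_true, true_and,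
    and_true]
  tauto

variable {α : Type*} (f : Letter → α)

theorem range_eq : Set.range f = {f a, f b, f c} := by
  ext y
  simp only [Set.mem_range, exists_iff, Set.mem_insert_iff, Set.mem_singleton_iff, eq_comm]

theorem ncard_range_trichotomy :
    ((Set.range f).ncard = 1 ↔ ∀ k, ¬ ∀ j, f j = f k → j = k) ∧
    ((Set.range f).ncard = 2 ↔ ∃! k, ∀ j, f j = f k → j = k) ∧
    ((Set.range f).ncard = 3 ↔ ∀ k, ∀ j, f j = f k → j = k) := by
  rw [range_eq, existsUnique_iff]
  simp only [forall_iff]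
  by_cases hab : f a = f b <;> by_cases hbc : f b = f c <;> by_cases hac : f a = f c <;>
    simp_all [eq_comm]

end Letter

namespace ThreeButterfly

variable (B : ThreeButterfly)

section Labels

theorem size_pos (k : Letter) : 0 < B.size k := by
  have := B.q_le_p
  have := B.s_le_q
  have := B.two_le_s
  cases k <;> simp only [size] <;> omega

instance (k : Letter) : NeZero (2 * B.size k) :=
  ⟨(Nat.mul_pos two_pos (B.size_pos k)).ne'⟩

/-- The end of the bridge `k` with label `0`. -/
abbrev start (k : Letter) : B.Vertex := ⟨k, 0⟩

/-- The end of the bridge `k` with label `size k`. -/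
abbrev finish (k : Letter) : B.Vertex := ⟨k, (B.size k : ZMod (2 * B.size k))⟩

theorem t_add_w : B.t + B.w = 2 * B.p := by
  have := B.q_le_p
  have := B.s_le_q
  unfold t w
  omega

theorem t_add_v : B.t + B.v = 2 * B.q := by
  have := B.q_le_p
  have := B.s_le_q
  have := B.p_lt
  unfold t v
  omega

theorem v_add_w : B.v + B.w = 2 * B.s := by
  have := B.q_le_p
  have := B.p_lt
  unfold v w
  omega

theorem natCast_two_mul_size_sub (k : Letter) {i : ℕ} (h : i ≤ 2 * B.size k) :
    ((2 * B.size k - i : ℕ) : ZMod (2 * B.size k)) = -i := by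
  rw [Nat.cast_sub h, ZMod.natCast_self, zero_sub]

theorem val_natCast_size (k : Letter) :
    (B.size k : ZMod (2 * B.size k)).val = B.size k :=
  ZMod.val_cast_of_lt (by have := B.size_pos k; omega)

end Labels

section Involutions

theorem gamma_involutive : Function.Involutive B.gamma := B.gamma.left_inv

theorem phi_involutive : Function.Involutive B.phi := B.phiFun_involutive

theorem gamma_eq_self_iff {x : B.Vertex} :
    B.gamma x = x ↔ x = B.start x.1 ∨ x = B.finish x.1 := by
  obtain ⟨k, z⟩ := x
  have hval : 2 * z.val = 2 * B.size k ↔ z = B.size k := by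
    rw [Nat.mul_right_inj two_ne_zero, ← (ZMod.val_injective _).eq_iff, val_natCast_size]
  simp only [gamma, Equiv.coe_fn_mk, Sigma.mk.injEq, heq_eq_eq, true_and, ZMod.neg_eq_self_iff,
    hval]

theorem gamma_start (k : Letter) : B.gamma (B.start k) = B.start k :=
  B.gamma_eq_self_iff.2 (Or.inl rfl)

theorem gamma_finish (k : Letter) : B.gamma (B.finish k) = B.finish k :=
  B.gamma_eq_self_iff.2 (Or.inr rfl)

theorem finish_ne_start (j k : Letter) : B.finish j ≠ B.start k := by
  intro h
  obtain rfl : j = k := congrArg Sigma.fst h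
  have hzero : (B.size j : ZMod (2 * B.size j)) = 0 := eq_of_heq (Sigma.mk.inj h).2
  have hval := B.val_natCast_size j
  rw [hzero, ZMod.val_zero] at hval
  exact (B.size_pos j).ne hval

theorem phi_ne_self (x : B.Vertex) : B.phi x ≠ x := by
  intro h
  have hletter : (B.phiFun x).1 = x.1 := congrArg Sigma.fst h
  obtain ⟨k, x⟩ := x
  cases k <;> simp only [phiFun, phiA, phiB, phiC] at hletter <;> split_ifs at hletter

theorem phi_b_add {j : ℕ} (h : j < B.t) : B.phi (B.b (B.m + j)) = B.a (B.n - j - 1) :=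
  B.phiFun_b_add j h

theorem phi_c_add {j : ℕ} (h : j < B.v) : B.phi (B.c (B.l + j)) = B.b (B.m - j - 1) :=
  B.phiFun_c_add j h

theorem phi_c_sub {i : ℕ} (h0 : 1 ≤ i) (h1 : i ≤ B.w) :
    B.phi (B.c (B.l - i)) = B.a (B.n + i - 1) :=
  B.phiFun_c_sub i h0 h1

end Involutions

section Strands

theorem strand_gamma_of_gamma_ne_self {x : B.Vertex} (hx : B.gamma x ≠ x) :
    B.Strand (B.label x) (B.label (B.gamma x)) ∨ B.Strand (B.label (B.gamma x)) (B.label x) := by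
  have hunder : ∀ {k : Letter} {i : ℕ}, 0 < i → i < B.size k →
      B.Strand (B.label ⟨k, i⟩) (B.label ⟨k, -i⟩) := by
    intro k i h0 h1
    rw [← B.natCast_two_mul_size_sub k (by omega)]
    exact Strand.under k i h0 h1
  obtain ⟨k, z⟩ := x
  obtain ⟨i, hi, rfl⟩ : ∃ i < 2 * B.size k, (i : ZMod (2 * B.size k)) = z :=
    ⟨z.val, z.val_lt, ZMod.natCast_zmod_val z⟩
  have hi_zero : i ≠ 0 := by
    rintro rfl
    exact hx (by simp [gamma])
  rcases lt_trichotomy i (B.size k) with hlt | rfl | hgt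
  · exact Or.inl (hunder (Nat.pos_of_ne_zero hi_zero) hlt)
  · exact absurd (B.gamma_finish k) hx
  · have hstrand := hunder (k := k) (i := 2 * B.size k - i) (by omega) (by omega)
    rw [B.natCast_two_mul_size_sub k hi.le, neg_neg] at hstrand
    exact Or.inr hstrand

theorem strand_phi (x : B.Vertex) :
    B.Strand (B.label x) (B.label (B.phi x)) ∨ B.Strand (B.label (B.phi x)) (B.label x) := by
  have htw := B.t_add_w
  have htv := B.t_add_v
  have hvw := B.v_add_w
  obtain ⟨k, z⟩ := x
  cases k with
  | a =>
    change ZMod (2 * B.p) at z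
    have hpos : 0 < 2 * B.p := NeZero.pos (2 * B.size .a)
    rcases residue_cases hpos B.w z B.n with ⟨j, hj, -, rfl⟩ | ⟨i, hi, hi', rfl⟩
    · rw [(B.phi_a_add j hj).1]
      simpa [sub_sub, ← add_assoc] using Or.inr (Strand.arcCA (j + 1) j.succ_pos hj)
    · have hit : i ≤ B.t := by omega
      rw [(B.phi_a_sub i hi hit).1]
      exact Or.inl (Strand.arcAB i hi hit)
  | b =>
    change ZMod (2 * B.q) at z
    have hpos : 0 < 2 * B.q := NeZero.pos (2 * B.size .b)
    rcases residue_cases hpos B.t z B.m with ⟨j, hj, -, rfl⟩ | ⟨i, hi, hi', rfl⟩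
    · rw [B.phi_b_add hj]
      simpa [sub_sub, ← add_assoc] using Or.inr (Strand.arcAB (j + 1) j.succ_pos hj)
    · have hiv : i ≤ B.v := by omega
      rw [(B.phi_b_sub i hi hiv).1]
      exact Or.inl (Strand.arcBC i hi hiv)
  | c =>
    change ZMod (2 * B.s) at z
    have hpos : 0 < 2 * B.s := NeZero.pos (2 * B.size .c)
    rcases residue_cases hpos B.v z B.l with ⟨j, hj, -, rfl⟩ | ⟨i, hi, hi', rfl⟩
    · rw [B.phi_c_add hj]
      simpa [sub_sub, ← add_assoc] using Or.inr (Strand.arcBC (j + 1) j.succ_pos hj)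
    · have hiw : i ≤ B.w := by omega
      rw [B.phi_c_sub hi hiw]
      exact Or.inl (Strand.arcCA i hi hiw)

end Strands

section Orbits

variable {B} {x y : B.Vertex} {j k : Letter}

theorem gamma_mem_orbitMu_iff (hx : B.gamma x = x) :
    B.gamma y ∈ B.orbitMu x ↔ y ∈ B.orbitMu x := by
  have hstep : ∀ z ∈ B.orbitMu x, B.gamma z ∈ B.orbitMu x := fun _ =>
    right_apply_mem_orbit_zpowers_mul B.phi_involutive B.gamma_involutive hx
  exact ⟨fun h => by simpa only [B.gamma_involutive y] using hstep _ h, hstep y⟩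

theorem phi_mem_orbitMu_iff (hx : B.gamma x = x) :
    B.phi y ∈ B.orbitMu x ↔ y ∈ B.orbitMu x := by
  have hstep : ∀ z ∈ B.orbitMu x, B.phi z ∈ B.orbitMu x := fun _ =>
    left_apply_mem_orbit_zpowers_mul B.phi_involutive B.gamma_involutive hx
  exact ⟨fun h => by simpa only [B.phi_involutive y] using hstep _ h, hstep y⟩

theorem exists_fixedPoints_gamma_inter_orbitMu_eq_pair (hx : B.gamma x = x) :
    ∃ y ≠ x, Function.fixedPoints B.gamma ∩ B.orbitMu x = {x, y} :=
  exists_fixedPoints_inter_orbit_zpowers_mul_eq_pair B.phi_involutive B.phi_ne_self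
    B.gamma_involutive hx (B.mu.injective.mem_periodicPts x)

theorem fixedPoints_gamma_inter_orbitMu_start (h : B.finish k ∈ B.orbitMu (B.start k)) :
    Function.fixedPoints B.gamma ∩ B.orbitMu (B.start k) = {B.start k, B.finish k} := by
  obtain ⟨y, -, hpair⟩ := exists_fixedPoints_gamma_inter_orbitMu_eq_pair (B.gamma_start k)
  have hfinish : B.finish k ∈ ({B.start k, y} : Set B.Vertex) := hpair ▸ ⟨B.gamma_finish k, h⟩
  rw [hpair, hfinish.resolve_left (B.finish_ne_start k k)]

theorem start_mem_orbitMu_iff (h : B.finish k ∈ B.orbitMu (B.start k)) :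
    B.start j ∈ B.orbitMu (B.start k) ↔ j = k := by
  refine ⟨fun hj => ?_, fun hj => hj ▸ MulAction.mem_orbit_self _⟩
  have hpair : B.start j ∈ ({B.start k, B.finish k} : Set B.Vertex) :=
    fixedPoints_gamma_inter_orbitMu_start h ▸ ⟨B.gamma_start j, hj⟩
  exact hpair.elim (congrArg Sigma.fst) (congrArg Sigma.fst)

theorem finish_mem_orbitMu_iff (h : B.finish k ∈ B.orbitMu (B.start k)) :
    B.finish j ∈ B.orbitMu (B.start k) ↔ j = k := by
  refine ⟨fun hj => ?_, fun hj => hj ▸ h⟩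
  have hpair : B.finish j ∈ ({B.start k, B.finish k} : Set B.Vertex) :=
    fixedPoints_gamma_inter_orbitMu_start h ▸ ⟨B.gamma_finish j, hj⟩
  exact hpair.elim (congrArg Sigma.fst) (congrArg Sigma.fst)

end Orbits

section Components

variable {B} {x y : B.Vertex} {j k : Letter}

theorem Strand.reachable {u v : B.Site} (h : B.Strand u v) : B.link.Reachable u v :=
  reachable_fromRel_of_rel h

theorem reachable_gamma (x : B.Vertex) : B.link.Reachable (B.label x) (B.label (B.gamma x)) := by
  by_cases hx : B.gamma x = x
  · rw [hx]
  · exact (B.strand_gamma_of_gamma_ne_self hx).elim Strand.reachable fun h => h.reachable.symm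

theorem reachable_phi (x : B.Vertex) : B.link.Reachable (B.label x) (B.label (B.phi x)) :=
  (B.strand_phi x).elim Strand.reachable fun h => h.reachable.symm

theorem reachable_mu (x : B.Vertex) : B.link.Reachable (B.label x) (B.label (B.mu x)) :=
  (reachable_gamma x).trans (reachable_phi (B.gamma x))

theorem reachable_of_mem_orbitMu (h : y ∈ B.orbitMu x) :
    B.link.Reachable (B.label x) (B.label y) := by
  obtain ⟨i, rfl⟩ := mem_orbit_zpowers_iff_exists_zpow_apply_eq.1 h
  refine zpow_induction_left
    (P := fun σ : Equiv.Perm B.Vertex => B.link.Reachable (B.label x) (B.label (σ x)))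
    (SimpleGraph.Reachable.refl _) (fun σ hσ => hσ.trans (reachable_mu _)) (fun σ hσ => ?_) i
  have hback := reachable_mu (B.mu.symm (σ x))
  rw [Equiv.apply_symm_apply] at hback
  exact hσ.trans hback.symm

variable (B) in
/-- The component of the link that runs along the bridge `k`. -/
def bridgeComponent (k : Letter) : B.link.ConnectedComponent :=
  B.link.connectedComponentMk (B.onBridge k 0)

theorem connectedComponentMk_onBridge (i : Fin (B.size k + 1)) :
    B.link.connectedComponentMk (B.onBridge k i) = B.bridgeComponent k := by
  induction i using Fin.induction with
  | zero => rfl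
  | succ i ih =>
    rw [← ih]
    exact SimpleGraph.ConnectedComponent.sound (Strand.bridge k i).reachable.symm

theorem connectedComponentMk_start (k : Letter) :
    B.link.connectedComponentMk (B.label (B.start k)) = B.bridgeComponent k :=
  SimpleGraph.ConnectedComponent.sound (Strand.bridgeStart k).reachable

theorem connectedComponentMk_finish (k : Letter) :
    B.link.connectedComponentMk (B.label (B.finish k)) = B.bridgeComponent k :=
  (SimpleGraph.ConnectedComponent.sound (Strand.bridgeEnd k).reachable).trans
    (connectedComponentMk_onBridge _)

theorem exists_ne_bridgeComponent_eq (h : B.finish k ∉ B.orbitMu (B.start k)) :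
    ∃ j ≠ k, B.bridgeComponent j = B.bridgeComponent k := by
  obtain ⟨y, hne, hpair⟩ := exists_fixedPoints_gamma_inter_orbitMu_eq_pair (B.gamma_start k)
  obtain ⟨hfixed, hmem⟩ : y ∈ Function.fixedPoints B.gamma ∩ B.orbitMu (B.start k) := by
    rw [hpair]
    exact Or.inr rfl
  have hcomp : B.link.connectedComponentMk (B.label y) = B.bridgeComponent k := by
    rw [← connectedComponentMk_start]
    exact SimpleGraph.ConnectedComponent.sound (reachable_of_mem_orbitMu hmem).symm
  obtain ⟨j, rfl | rfl⟩ : ∃ j, y = B.start j ∨ y = B.finish j :=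
    ⟨y.1, B.gamma_eq_self_iff.1 hfixed⟩
  · exact ⟨j, fun hj => hne (hj ▸ rfl), (connectedComponentMk_start j).symm.trans hcomp⟩
  · exact ⟨j, fun hj => h (hj ▸ hmem), (connectedComponentMk_finish j).symm.trans hcomp⟩

variable (B) in
/-- The bridge `k` together with the labels in the orbit of its end `k_0` under `μ`. It is a closed
curve when this orbit contains the other end of the bridge as well. -/
def bridgeWithOrbit (k : Letter) : Set B.Site :=
  Sum.inl '' B.orbitMu (B.start k) ∪ Sum.inr '' {site | site.1 = k}

theorem label_mem_bridgeWithOrbit :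
    B.label x ∈ B.bridgeWithOrbit k ↔ x ∈ B.orbitMu (B.start k) := by
  simp [bridgeWithOrbit]

theorem onBridge_mem_bridgeWithOrbit {i : Fin (B.size j + 1)} :
    B.onBridge j i ∈ B.bridgeWithOrbit k ↔ j = k := by
  simp [bridgeWithOrbit]

theorem Strand.mem_bridgeWithOrbit_iff (h : B.finish k ∈ B.orbitMu (B.start k)) {u v : B.Site}
    (huv : B.Strand u v) : u ∈ B.bridgeWithOrbit k ↔ v ∈ B.bridgeWithOrbit k := by
  have hphi : ∀ {x y}, B.phi x = y → (x ∈ B.orbitMu (B.start k) ↔ y ∈ B.orbitMu (B.start k)) := by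
    rintro x _ rfl
    exact (phi_mem_orbitMu_iff (B.gamma_start k)).symm
  cases huv <;> simp only [label_mem_bridgeWithOrbit, onBridge_mem_bridgeWithOrbit]
  case bridgeStart => exact start_mem_orbitMu_iff h
  case bridgeEnd => exact finish_mem_orbitMu_iff h
  case under j i h0 h1 =>
    rw [B.natCast_two_mul_size_sub j (by omega)]
    exact (gamma_mem_orbitMu_iff (B.gamma_start k)).symm
  case arcAB j h0 h1 => exact hphi (B.phi_a_sub j h0 h1).1
  case arcBC j h0 h1 => exact hphi (B.phi_b_sub j h0 h1).1
  case arcCA j h0 h1 => exact hphi (B.phi_c_sub h0 h1)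

theorem eq_of_bridgeComponent_eq (h : B.finish k ∈ B.orbitMu (B.start k))
    (hjk : B.bridgeComponent j = B.bridgeComponent k) : j = k := by
  have hmem : B.onBridge j 0 ∈ B.bridgeWithOrbit k ↔ B.onBridge k 0 ∈ B.bridgeWithOrbit k :=
    mem_iff_mem_of_reachable_fromRel (fun _ _ => Strand.mem_bridgeWithOrbit_iff h)
      (SimpleGraph.ConnectedComponent.exact hjk)
  rw [onBridge_mem_bridgeWithOrbit, onBridge_mem_bridgeWithOrbit] at hmem
  exact hmem.2 rfl

theorem forall_bridgeComponent_eq_imp_eq_iff :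
    (∀ j, B.bridgeComponent j = B.bridgeComponent k → j = k) ↔
      B.finish k ∈ B.orbitMu (B.start k) := by
  refine ⟨fun hsep => ?_, fun h _ => eq_of_bridgeComponent_eq h⟩
  by_contra h
  obtain ⟨j, hne, heq⟩ := exists_ne_bridgeComponent_eq h
  exact hne (hsep j heq)

theorem ncard_range_bridgeComponent_trichotomy (B : ThreeButterfly) :
    ((Set.range B.bridgeComponent).ncard = 1 ↔ ∀ k, B.finish k ∉ B.orbitMu (B.start k)) ∧
    ((Set.range B.bridgeComponent).ncard = 2 ↔ ∃! k, B.finish k ∈ B.orbitMu (B.start k)) ∧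
    ((Set.range B.bridgeComponent).ncard = 3 ↔ ∀ k, B.finish k ∈ B.orbitMu (B.start k)) := by
  simpa only [forall_bridgeComponent_eq_imp_eq_iff] using
    Letter.ncard_range_trichotomy B.bridgeComponent

theorem IsSchubertForm.numComponents_eq_ncard_range (hB : B.IsSchubertForm) :
    B.numComponents = (Set.range B.bridgeComponent).ncard := by
  have hsurj : Function.Surjective B.bridgeComponent := fun K => by
    obtain ⟨k, i, rfl⟩ := hB K
    exact ⟨k, (connectedComponentMk_onBridge i).symm⟩
  rw [hsurj.range_eq, Set.ncard_univ, numComponents]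

end Components

end ThreeButterfly

theorem mainTheorem5 (B : ThreeButterfly) (hB : B.IsSchubertForm) :
    (B.numComponents = 1 ↔
      B.a B.p ∉ B.orbitMu (B.a 0) ∧ B.b B.q ∉ B.orbitMu (B.b 0) ∧
        B.c B.s ∉ B.orbitMu (B.c 0)) ∧
    (B.numComponents = 2 ↔
      (B.a B.p ∈ B.orbitMu (B.a 0) ∧ B.b B.q ∉ B.orbitMu (B.b 0) ∧
        B.c B.s ∉ B.orbitMu (B.c 0)) ∨
      (B.a B.p ∉ B.orbitMu (B.a 0) ∧ B.b B.q ∈ B.orbitMu (B.b 0) ∧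
        B.c B.s ∉ B.orbitMu (B.c 0)) ∨
      (B.a B.p ∉ B.orbitMu (B.a 0) ∧ B.b B.q ∉ B.orbitMu (B.b 0) ∧
        B.c B.s ∈ B.orbitMu (B.c 0))) ∧
    (B.numComponents = 3 ↔
      B.a B.p ∈ B.orbitMu (B.a 0) ∧ B.b B.q ∈ B.orbitMu (B.b 0) ∧
        B.c B.s ∈ B.orbitMu (B.c 0)) := by
  rw [hB.numComponents_eq_ncard_range]
  obtain ⟨hone, htwo, hthree⟩ := B.ncard_range_bridgeComponent_trichotomy
  exact ⟨hone.trans Letter.forall_iff, htwo.trans Letter.existsUnique_iff,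
    hthree.trans Letter.forall_iff⟩
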